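/- Let $R$ be a commutative ring. For $r\in R$, let $R[r^{-1}]$ denote the localization of $R$ at the multiplicative subset $\{1,r,r^2,\dots\}$; an $R$-module $C$ is called $r$-contraadjusted if $\operatorname{Ext}^1_R(R[r^{-1}],C)=0$. For a finite set $\mathbf r=\{r_1,\dots,r_m\}$ of elements of $R$, an $R$-module $C$ is called $\mathbf r$-contraadjusted if it is $r_j$-contraadjusted for every $j=1,\dots,m$, and an $R$-module $F$ is called $\mathbf r$-very flat if $\operatorname{Ext}^1_R(F,C)=0$ for all $\mathbf r$-contraadjusted $R$-modules $C$. An $R$-module $F$ is called finitely very flat if there exists a finite set $\mathbf r$ of elements of $R$ such that $F$ is $\mathbf r$-very flat. Theorem. Let $R$ be a commutative ring, let $S$ be a finitely presented commutative $R$-algebra, and let $F$ be a finitely presented $S$-module. Assume that $F$ is flat as an $R$-module. Then $F$ is a finitely very flat $R$-module. -/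

import Mathlib

open CategoryTheory

universe u v w

/-- An `R`-module `C` is `r`-contraadjusted, for an element `r` of the commutative ring `R`, if
`Ext¹_R(R[r⁻¹], C) = 0`.  Here `R[r⁻¹]`, as an `R`-module, is `Localization.Away r`, moved by
`ULift` to the universe in which `C` lives. -/
def IsElementContraadjusted {R : Type u} [CommRing R] (r : R)
    (C : Type (max u v)) [AddCommGroup C] [Module R C] : Prop :=
  Subsingleton (Abelian.Ext
    (ModuleCat.of.{max u v} R (ULift.{v} (Localization.Away r)))
    (ModuleCat.of.{max u v} R C) 1)

/-- For a finite set `r` of elements of `R`, an `R`-module `C` is `r`-contraadjusted if it is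
`s`-contraadjusted for every `s ∈ r`. -/
def IsContraadjusted {R : Type u} [CommRing R] (r : Finset R)
    (C : Type (max u v)) [AddCommGroup C] [Module R C] : Prop :=
  ∀ s ∈ r, IsElementContraadjusted.{u, v} s C

/-- For a finite set `r` of elements of `R`, an `R`-module `F` is `r`-very flat if
`Ext¹_R(F, C) = 0` for every `r`-contraadjusted `R`-module `C`. -/
def IsVeryFlatWrt {R : Type u} [CommRing R] (r : Finset R)
    (F : Type (max u v)) [AddCommGroup F] [Module R F] : Prop :=
  ∀ (C : Type (max u v)) [AddCommGroup C] [Module R C],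
    IsContraadjusted.{u, v} r C →
      Subsingleton (Abelian.Ext (ModuleCat.of.{max u v} R F) (ModuleCat.of.{max u v} R C) 1)

/-- An `R`-module `F` is finitely very flat if it is `r`-very flat for some finite set `r` of
elements of `R`. -/
def IsFinitelyVeryFlat (R : Type u) [CommRing R]
    (F : Type (max u v)) [AddCommGroup F] [Module R F] : Prop :=
  ∃ r : Finset R, IsVeryFlatWrt.{u, v} r F

/-! The proof rests on a gluing principle, `exists_isSeqVeryFlat_of_quotient_of_away`: a flat module
is finitely very flat as soon as its reduction modulo `r` and its localization at `r` are so over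
`R/r` and `R[r⁻¹]`. Let `0 → K → P → F → 0` be exact with `P` projective, and let `φ : K → C`.
Modulo `r` the map extends to `P`, so `φ = ψ ∘ i + r φ'`; iterating gives `φ_n = ψ_n ∘ i + r
φ_{n+1}`. Since `C` is `r`-contraadjusted, `ψ_n = β_n - r β_{n+1}` can be solved, and `γ_n = φ_n -
β_n ∘ i` satisfies `γ_n = r γ_{n+1}`. Thus `γ` is a map from `K` to `Hom(R[r⁻¹], C)`, an
`R[r⁻¹]`-module, and it extends by the hypothesis over `R[r⁻¹]`.

To apply this, write `F = R ⊗ F₀` with `F₀` finite over a polynomial ring over a Noetherian ring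
`R₀`. Generic freeness makes `F₀` projective on a dense open part of each irreducible closed subset
of `Spec R₀`, and Noetherian induction on ideals of `R₀` glues the pieces. Flatness need not descend
to `F₀`: the induction ranges over all `R₀`-algebras `A` with `A ⊗ F₀` flat.

Ext groups are replaced throughout by extension problems along a projective presentation, and
contraadjustedness by solvability of `b n - r b (n + 1) = c n`. -/

open TensorProduct

/-! ### Ext¹ through projective presentations, and contraadjustedness through sequences. -/

section Presentations

variable {R : Type*} [CommRing R]

/-- The sequence form of contraadjustedness: the map `b ↦ (b n - r • b (n + 1))` is surjective on
sequences in `C`. -/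
def IsSeqContraadjusted (r : R) (C : Type*) [AddCommGroup C] [Module R C] : Prop :=
  ∀ c : ℕ → C, ∃ b : ℕ → C, ∀ n, b n - r • b (n + 1) = c n

/-- Homomorphisms to `C` from the kernel of the tautological free presentation of `F` extend to the
free module. -/
def ExtVanishes (R : Type*) [CommRing R] (F : Type*) [AddCommGroup F] [Module R F]
    (C : Type*) [AddCommGroup C] [Module R C] : Prop :=
  ∀ φ : LinearMap.ker (Finsupp.linearCombination R (id : F → F)) →ₗ[R] C,
    ∃ ψ : (F →₀ R) →ₗ[R] C, ψ ∘ₗ Submodule.subtype _ = φ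

theorem LinearMap.exists_comp_eq_of_injective {K L Q : Type*} [AddCommGroup K] [Module R K]
    [AddCommGroup L] [Module R L] [AddCommGroup Q] [Module R Q] (j : L →ₗ[R] Q)
    (hj : Function.Injective j) (f : K →ₗ[R] Q) (hf : ∀ x, f x ∈ LinearMap.range j) :
    ∃ g : K →ₗ[R] L, j ∘ₗ g = f := by
  refine ⟨(LinearEquiv.ofInjective j hj).symm.toLinearMap ∘ₗ f.codRestrict _ hf, ?_⟩
  ext x
  simp

theorem LinearMap.exists_comp_eq_of_surjective {K L Q : Type*} [AddCommGroup K] [Module R K]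
    [AddCommGroup L] [Module R L] [AddCommGroup Q] [Module R Q] (g : K →ₗ[R] L)
    (hg : Function.Surjective g) (f : K →ₗ[R] Q) (hf : ∀ x, g x = 0 → f x = 0) :
    ∃ f' : L →ₗ[R] Q, f' ∘ₗ g = f := by
  refine ⟨(LinearMap.ker g).liftQ f hf ∘ₗ (g.quotKerEquivOfSurjective hg).symm.toLinearMap, ?_⟩
  ext y
  have : (g.quotKerEquivOfSurjective hg).symm (g y) = (LinearMap.ker g).mkQ y := by
    rw [LinearEquiv.symm_apply_eq]; rfl
  simp only [LinearMap.comp_apply, LinearEquiv.coe_coe, this]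
  rfl

variable {F : Type*} [AddCommGroup F] [Module R F] {C : Type*} [AddCommGroup C] [Module R C]
  {K P L Q : Type*} [AddCommGroup K] [Module R K] [AddCommGroup P] [Module R P]
  [AddCommGroup L] [Module R L] [AddCommGroup Q] [Module R Q]

/-- Independence of the presentation. The lifts `α : Q → P` and `β : P → Q` of the identity of `F`
compose to `β ∘ α = id + j ∘ δ`; the term `φ ∘ δ` corrects for this. -/
theorem exists_extension_of_presentation [Module.Projective R P] [Module.Projective R Q]
    {i : K →ₗ[R] P} {p : P →ₗ[R] F} (hp : Function.Surjective p)
    (he : Function.Exact i p) {j : L →ₗ[R] Q} {q : Q →ₗ[R] F} (hj : Function.Injective j)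
    (hq : Function.Surjective q) (he' : Function.Exact j q)
    (H : ∀ φ : K →ₗ[R] C, ∃ ψ : P →ₗ[R] C, ψ ∘ₗ i = φ) (φ : L →ₗ[R] C) :
    ∃ ψ : Q →ₗ[R] C, ψ ∘ₗ j = φ := by
  obtain ⟨α, hα⟩ := Module.projective_lifting_property p q hp
  obtain ⟨β, hβ⟩ := Module.projective_lifting_property q p hq
  have hα' (x) : p (α x) = q x := LinearMap.congr_fun hα x
  have hβ' (x) : q (β x) = p x := LinearMap.congr_fun hβ x
  obtain ⟨β', h1⟩ := LinearMap.exists_comp_eq_of_injective j hj (β ∘ₗ i) fun x ↦ by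
    rw [LinearMap.mem_range]
    exact (he' _).1 (by simp [hβ', he.apply_apply_eq_zero])
  obtain ⟨δ, h2⟩ := LinearMap.exists_comp_eq_of_injective j hj (β ∘ₗ α - LinearMap.id) fun x ↦ by
    rw [LinearMap.mem_range]
    exact (he' _).1 (by simp [hβ', hα'])
  obtain ⟨ψ, hψ⟩ := H (φ ∘ₗ β')
  refine ⟨ψ ∘ₗ α - φ ∘ₗ δ, LinearMap.ext fun y ↦ ?_⟩
  obtain ⟨k, hk⟩ := (he (α (j y))).1 (by simp [hα', he'.apply_apply_eq_zero])
  have h3 : β' k = y + δ (j y) := hj <| by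
    have h4 := LinearMap.congr_fun h1 k
    have h5 := LinearMap.congr_fun h2 (j y)
    simp only [LinearMap.comp_apply, LinearMap.sub_apply, LinearMap.id_apply] at h4 h5
    rw [h4, hk, map_add, h5]; abel
  have h6 := LinearMap.congr_fun hψ k
  simp only [LinearMap.comp_apply] at h6
  simp [← hk, h6, h3]

theorem linearCombination_id_surjective :
    Function.Surjective (Finsupp.linearCombination R (id : F → F)) :=
  Finsupp.linearCombination_id_surjective R F

theorem extVanishes_iff [Module.Projective R P] {i : K →ₗ[R] P} {p : P →ₗ[R] F}
    (hi : Function.Injective i) (hp : Function.Surjective p) (he : Function.Exact i p) :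
    ExtVanishes R F C ↔ ∀ φ : K →ₗ[R] C, ∃ ψ : P →ₗ[R] C, ψ ∘ₗ i = φ :=
  ⟨fun H ↦ exists_extension_of_presentation linearCombination_id_surjective
      (LinearMap.exact_subtype_ker_map _) hi hp he H,
    fun H ↦ exists_extension_of_presentation hp he (Submodule.subtype_injective _)
      linearCombination_id_surjective (LinearMap.exact_subtype_ker_map _) H⟩

theorem extVanishes_of_projective [Module.Projective R F] : ExtVanishes R F C := by
  rw [extVanishes_iff (i := (0 : PUnit →ₗ[R] F)) (p := LinearMap.id)
    (Function.injective_of_subsingleton _) Function.surjective_id]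
  · exact fun φ ↦ ⟨0, LinearMap.ext fun x ↦ by rw [Subsingleton.elim x 0, map_zero, map_zero]⟩
  · intro y
    simp [eq_comm]

theorem ExtVanishes.of_equiv {F' : Type*} [AddCommGroup F'] [Module R F'] (e : F ≃ₗ[R] F')
    (h : ExtVanishes R F C) : ExtVanishes R F' C := by
  let p := Finsupp.linearCombination R (id : F → F)
  have hp : Function.Surjective (e.toLinearMap ∘ₗ p) :=
    e.surjective.comp linearCombination_id_surjective
  have he : Function.Exact (LinearMap.ker p).subtype (e.toLinearMap ∘ₗ p) := fun y ↦ by simp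
  exact (extVanishes_iff (Submodule.subtype_injective _) hp he).2 h

theorem IsSeqContraadjusted.of_surjective {r : R} {C' : Type*} [AddCommGroup C'] [Module R C']
    (f : C →ₗ[R] C') (hf : Function.Surjective f) (h : IsSeqContraadjusted r C) :
    IsSeqContraadjusted r C' := by
  intro c
  choose c' hc' using fun n ↦ hf (c n)
  obtain ⟨b, hb⟩ := h c'
  exact ⟨fun n ↦ f (b n), fun n ↦ by rw [← map_smul, ← map_sub, hb, hc']⟩

-- Multiplication by `1 - rX` on `R[X]` has cokernel `R[r⁻¹]`; on the basis `X ^ n`, extending a map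
-- along it is exactly the sequence equation.
open Polynomial in
theorem isSeqContraadjusted_of_forall_polynomial (r : R)
    (h : ∀ g : R[X] →ₗ[R] C, ∃ f : R[X] →ₗ[R] C, ∀ x, f ((1 - Polynomial.C r * X) * x) = g x) :
    IsSeqContraadjusted r C := by
  intro c
  obtain ⟨f, hf⟩ := h ((Polynomial.basisMonomials R).constr ℕ c)
  refine ⟨fun n ↦ f (X ^ n), fun n ↦ ?_⟩
  have := hf (X ^ n)
  have h1 : (Polynomial.basisMonomials R).constr ℕ c (X ^ n : R[X]) = c n := by
    have := (Polynomial.basisMonomials R).constr_basis ℕ c n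
    simpa only [Polynomial.coe_basisMonomials, Polynomial.X_pow_eq_monomial] using this
  rw [h1] at this
  rw [← this, ← map_smul, ← map_sub]
  congr 1
  rw [Polynomial.smul_eq_C_mul]
  ring

open Polynomial in
theorem one_sub_C_mul_X_mul_injective (r : R) :
    Function.Injective (LinearMap.mulLeft R (1 - Polynomial.C r * X : R[X])) := by
  rw [injective_iff_map_eq_zero]
  intro x hx
  rw [LinearMap.mulLeft_apply, sub_mul, one_mul, sub_eq_zero, mul_assoc] at hx
  ext n
  induction n with
  | zero => rw [hx]; simp
  | succ n ih => rw [hx, Polynomial.coeff_C_mul, Polynomial.coeff_X_mul, ih]; simp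

end Presentations

/-! ### Very flat modules have projective dimension at most one. -/

section VeryFlat

variable {R : Type u} [CommRing R]

theorem isSeqContraadjusted_of_injective (r : R) (E : Type (max u v)) [AddCommGroup E] [Module R E]
    [Module.Injective R E] : IsSeqContraadjusted r E := by
  refine isSeqContraadjusted_of_forall_polynomial r fun g ↦ ?_
  obtain ⟨f, hf⟩ := Module.Injective.extension_property R E _ _ _
    (one_sub_C_mul_X_mul_injective r) g
  exact ⟨f, fun x ↦ by simpa using LinearMap.congr_fun hf x⟩

theorem exists_injective_module (X : Type (max u v)) [AddCommGroup X] [Module R X] :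
    ∃ (E : Type (max u v)) (_ : AddCommGroup E) (_ : Module R E) (_ : Module.Injective R E)
      (f : X →ₗ[R] E), Function.Injective f := by
  let I := Injective.under (ModuleCat.of.{max u v} R X)
  refine ⟨I, inferInstance, inferInstance, ?_, (Injective.ι (ModuleCat.of.{max u v} R X)).hom, ?_⟩
  · rw [Module.injective_iff_injective_object]
    exact inferInstanceAs (Injective I)
  · exact (ModuleCat.mono_iff_injective _).1 inferInstance

/-- Very flatness with respect to `s`, in terms of presentations and sequences. -/
def IsSeqVeryFlat (s : Finset R) (F : Type (max u v)) [AddCommGroup F] [Module R F] : Prop :=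
  ∀ (C : Type (max u v)) [AddCommGroup C] [Module R C],
    (∀ r ∈ s, IsSeqContraadjusted r C) → ExtVanishes R F C

variable {F : Type (max u v)} [AddCommGroup F] [Module R F]

theorem IsSeqVeryFlat.of_equiv {s : Finset R} {F' : Type (max u v)} [AddCommGroup F'] [Module R F']
    (e : F ≃ₗ[R] F') (h : IsSeqVeryFlat.{u, v} s F) : IsSeqVeryFlat.{u, v} s F' :=
  fun C _ _ hC ↦ (h C hC).of_equiv e

/-- Dimension shifting: quotients of injectives are contraadjusted for every element, so `Ext¹(F,
E/X) = 0`, whence `Ext²(F, X) = 0` and `Ext¹(K, X) = 0`. With `X` the kernel of a free cover of `K`,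
the cover splits. -/
theorem IsSeqVeryFlat.projective_syzygy {s : Finset R} (h : IsSeqVeryFlat.{u, v} s F)
    {K P : Type (max u v)} [AddCommGroup K] [Module R K] [AddCommGroup P] [Module R P]
    [Module.Projective R P] {i : K →ₗ[R] P} {p : P →ₗ[R] F}
    (hi : Function.Injective i) (hp : Function.Surjective p) (he : Function.Exact i p) :
    Module.Projective R K := by
  let g := Finsupp.linearCombination R (id : K → K)
  have hg : Function.Surjective g := linearCombination_id_surjective
  obtain ⟨E, _, _, _, ε, hε⟩ := exists_injective_module.{u, v} (R := R) (LinearMap.ker g)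
  obtain ⟨k, hk⟩ := Module.Injective.extension_property R E (LinearMap.ker g) (K →₀ R)
    (LinearMap.ker g).subtype
    (Submodule.subtype_injective _) ε
  have hk' (x : LinearMap.ker g) : k x = ε x := LinearMap.congr_fun hk x
  let X := LinearMap.range ε
  have hX : LinearMap.ker g ≤ LinearMap.ker (X.mkQ ∘ₗ k) := fun x hx ↦ by
    have : k x = ε ⟨x, hx⟩ := hk' ⟨x, hx⟩
    simp [this, X]
  obtain ⟨k', hk''⟩ := LinearMap.exists_comp_eq_of_surjective g hg (X.mkQ ∘ₗ k) hX
  replace hk'' (x) : k' (g x) = X.mkQ (k x) := LinearMap.congr_fun hk'' x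
  obtain ⟨ψ, hψ⟩ := (extVanishes_iff hi hp he).1 (h (E ⧸ X) fun r _ ↦
    (isSeqContraadjusted_of_injective.{u, v} r E).of_surjective X.mkQ X.mkQ_surjective) k'
  obtain ⟨χ, hχ⟩ := Module.projective_lifting_property X.mkQ ψ X.mkQ_surjective
  -- After subtracting `χ ∘ i ∘ g` the map lands in `X ≅ ker g`, and it is unchanged on `ker g`; so
  -- it is a retraction onto `ker g`.
  obtain ⟨ρ, hρ⟩ := LinearMap.exists_comp_eq_of_injective ε hε (k - χ ∘ₗ i ∘ₗ g) fun x ↦ by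
    have h1 := LinearMap.congr_fun hχ (i (g x))
    have h2 := LinearMap.congr_fun hψ (g x)
    simp only [LinearMap.comp_apply] at h1 h2
    have : X.mkQ ((k - χ ∘ₗ i ∘ₗ g) x) = 0 := by
      simp only [LinearMap.sub_apply, LinearMap.comp_apply, map_sub]
      rw [h1, h2, hk'', sub_self]
    exact (Submodule.Quotient.mk_eq_zero X).1 this
  have hρ' (x : LinearMap.ker g) : ρ x = x := hε <| by
    have h1 := LinearMap.congr_fun hρ x
    simp only [LinearMap.comp_apply, LinearMap.sub_apply] at h1
    rw [h1, hk', show g x = 0 from x.2]; simp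
  obtain ⟨σ, hσ⟩ := LinearMap.exists_comp_eq_of_surjective g hg
    (LinearMap.id - (LinearMap.ker g).subtype ∘ₗ ρ) fun x hx ↦ by
      have : ρ x = ⟨x, hx⟩ := hρ' ⟨x, hx⟩
      simp [this]
  refine Module.Projective.of_split σ g ?_
  ext x
  obtain ⟨y, rfl⟩ := hg x
  have h1 : σ (g y) = y - ρ y := LinearMap.congr_fun hσ y
  have h2 : g (ρ y : K →₀ R) = 0 := (ρ y).2
  simp [h1, h2]

end VeryFlat

theorem exists_projective_presentation (R : Type u) [CommRing R] (M : Type w) [AddCommGroup M]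
    [Module R M] : ∃ (K P : Type (max u w)) (_ : AddCommGroup K) (_ : Module R K)
      (_ : AddCommGroup P) (_ : Module R P) (_ : Module.Projective R P) (i : K →ₗ[R] P)
      (p : P →ₗ[R] M), Function.Injective i ∧ Function.Surjective p ∧ Function.Exact i p :=
  ⟨_, _, _, _, _, _, inferInstance, _, Finsupp.linearCombination R (id : M → M),
    Submodule.subtype_injective _, linearCombination_id_surjective,
    LinearMap.exact_subtype_ker_map _⟩

/-! ### Flatness and kernels of surjections. -/

section Flat

variable {R : Type*} [CommRing R] {K P F : Type*} [AddCommGroup K] [Module R K] [AddCommGroup P]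
  [Module R P] [AddCommGroup F] [Module R F]

theorem LinearMap.lTensor_rTensor_comm {A B A' B' : Type*} [AddCommGroup A] [Module R A]
    [AddCommGroup B] [Module R B] [AddCommGroup A'] [Module R A'] [AddCommGroup B'] [Module R B']
    (f : A →ₗ[R] B) (f' : A' →ₗ[R] B') (z : A ⊗[R] A') :
    f'.lTensor B (f.rTensor A' z) = f.rTensor B' (f'.lTensor A z) := by
  rw [← LinearMap.comp_apply, ← LinearMap.comp_apply, LinearMap.lTensor_comp_rTensor,
    LinearMap.rTensor_comp_lTensor]

/-- This is `Tor₁(N, F) = 0`, obtained by resolving `N` by `L → G` and chasing the diagram of tensor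
products. -/
theorem Module.Flat.lTensor_injective_of_exact [Module.Flat R F] {i : K →ₗ[R] P} {p : P →ₗ[R] F}
    (hi : Function.Injective i) (hp : Function.Surjective p) (he : Function.Exact i p)
    (N : Type*) [AddCommGroup N] [Module R N] : Function.Injective (i.lTensor N) := by
  obtain ⟨L, G, _, _, _, _, _, j, g, hj', hg, hj⟩ := exists_projective_presentation R N
  rw [injective_iff_map_eq_zero]
  intro x hx
  obtain ⟨x, rfl⟩ := LinearMap.rTensor_surjective K hg x
  rw [LinearMap.lTensor_rTensor_comm] at hx
  obtain ⟨y, hy⟩ := (_root_.rTensor_exact P hj hg _).1 hx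
  have hy' : p.lTensor _ y = 0 := by
    apply Module.Flat.rTensor_preserves_injective_linearMap (M := F) j
      hj'
    rw [← LinearMap.lTensor_rTensor_comm, hy, map_zero]
    exact (_root_.lTensor_exact _ he hp _).2 ⟨x, rfl⟩
  obtain ⟨z, rfl⟩ := (_root_.lTensor_exact _ he hp _).1 hy'
  rw [← LinearMap.lTensor_rTensor_comm] at hy
  have := Module.Flat.lTensor_preserves_injective_linearMap (M := G) i hi hy
  rw [← this]
  exact (_root_.rTensor_exact K hj hg _).2 ⟨z, rfl⟩

theorem Module.Flat.of_exact [Module.Flat R P] [Module.Flat R F] {i : K →ₗ[R] P} {p : P →ₗ[R] F}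
    (hi : Function.Injective i) (hp : Function.Surjective p) (he : Function.Exact i p) :
    Module.Flat R K := by
  rw [Module.Flat.iff_rTensor_injective']
  intro I
  have h1 : Function.Injective ((I.subtype.rTensor P) ∘ₗ (i.lTensor I)) :=
    (Module.Flat.rTensor_preserves_injective_linearMap (M := P) I.subtype
      (Submodule.subtype_injective _)).comp (lTensor_injective_of_exact hi hp he I)
  rw [LinearMap.rTensor_comp_lTensor, ← LinearMap.lTensor_comp_rTensor] at h1
  exact Function.Injective.of_comp h1

end Flat

/-! ### Reduction modulo one element. -/

section QuotientByElement

variable {R : Type*} [CommRing R] (r : R)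

theorem exists_one_tmul_quotient_span_singleton {M : Type*} [AddCommGroup M] [Module R M]
    (x : (R ⧸ Ideal.span {r}) ⊗[R] M) : ∃ m : M, (1 ⊗ₜ m : (R ⧸ Ideal.span {r}) ⊗[R] M) = x := by
  induction x with
  | zero => exact ⟨0, by simp⟩
  | add x y hx hy =>
    obtain ⟨m, rfl⟩ := hx
    obtain ⟨n, rfl⟩ := hy
    exact ⟨m + n, by simp [tmul_add]⟩
  | tmul a m =>
    obtain ⟨a, rfl⟩ := Ideal.Quotient.mk_surjective a
    exact ⟨a • m, by rw [← smul_tmul, Algebra.smul_def, mul_one]; rfl⟩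

theorem one_tmul_quotient_span_singleton_eq_zero_iff {M : Type*} [AddCommGroup M] [Module R M]
    (m : M) : (1 ⊗ₜ m : (R ⧸ Ideal.span {r}) ⊗[R] M) = 0 ↔ ∃ m' : M, m = r • m' := by
  rw [← (quotTensorEquivQuotSMul M (Ideal.span {r})).map_eq_zero_iff,
    quotTensorEquivQuotSMul_mk_one_tmul, Submodule.Quotient.mk_eq_zero,
    Submodule.ideal_span_singleton_smul, Submodule.mem_smul_pointwise_iff_exists]
  simp [eq_comm]

theorem smul_quotient_span_singleton_tmul_eq_zero {M : Type*} [AddCommGroup M] [Module R M]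
    (x : (R ⧸ Ideal.span {r}) ⊗[R] M) : r • x = 0 := by
  obtain ⟨m, rfl⟩ := exists_one_tmul_quotient_span_singleton r x
  rw [← tmul_smul]
  exact (one_tmul_quotient_span_singleton_eq_zero_iff r _).2 ⟨m, rfl⟩

theorem mk_one_quotient_span_singleton_surjective (M : Type*) [AddCommGroup M] [Module R M] :
    Function.Surjective (TensorProduct.mk R (R ⧸ Ideal.span {r}) M 1) :=
  exists_one_tmul_quotient_span_singleton r

/-- If `K` is flat and `K ⧸ r K` is projective over `R ⧸ r R`, a homomorphism `K → r C` can be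
divided by `r`. -/
theorem exists_smul_eq_of_projective_quotient {K C : Type*} [AddCommGroup K] [Module R K]
    [AddCommGroup C] [Module R C] [Module.Flat R K]
    [Module.Projective (R ⧸ Ideal.span {r}) ((R ⧸ Ideal.span {r}) ⊗[R] K)]
    (f : K →ₗ[R] C) (hf : ∀ x, ∃ c, f x = r • c) : ∃ g : K →ₗ[R] C, f = r • g := by
  let Q := R ⧸ Ideal.span {r}
  obtain ⟨L, G, _, _, _, _, _, j, g, hj', hg, hj⟩ := exists_projective_presentation R K
  obtain ⟨h, hh⟩ := Module.projective_lifting_property (LinearMap.lsmul R C r).rangeRestrict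
    ((f ∘ₗ g).codRestrict (LinearMap.range (LinearMap.lsmul R C r)) fun x ↦ by
      obtain ⟨c, hc⟩ := hf (g x)
      exact ⟨c, hc.symm⟩) (LinearMap.surjective_rangeRestrict _)
  replace hh : r • h = f ∘ₗ g := LinearMap.ext fun x ↦
    congrArg Subtype.val (LinearMap.congr_fun hh x)
  have hh' (x) : r • h x = f (g x) := LinearMap.congr_fun hh x
  obtain ⟨σ, hσ⟩ := Module.projective_lifting_property (g.baseChange Q) LinearMap.id
    (LinearMap.lTensor_surjective Q hg)
  have hjinj : Function.Injective (j.baseChange Q) :=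
    Module.Flat.lTensor_injective_of_exact hj' hg hj Q
  have hjex : Function.Exact (j.lTensor Q) (g.lTensor Q) := lTensor_exact Q hj hg
  obtain ⟨ρ, hρ⟩ := LinearMap.exists_comp_eq_of_injective (j.baseChange Q) hjinj
    (LinearMap.id - σ ∘ₗ g.baseChange Q) fun x ↦ (hjex _).1 (by
      have := LinearMap.congr_fun hσ (g.baseChange Q x)
      change g.baseChange Q (x - σ (g.baseChange Q x)) = 0
      rw [map_sub, sub_eq_zero]
      exact this.symm)
  have hρ' (l : L) : ρ (1 ⊗ₜ j l) = 1 ⊗ₜ l := hjinj <| by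
    have h1 := LinearMap.congr_fun hρ (1 ⊗ₜ j l)
    simp only [LinearMap.comp_apply, LinearMap.sub_apply, LinearMap.id_apply] at h1
    rw [h1, LinearMap.baseChange_tmul, LinearMap.baseChange_tmul, hj.apply_apply_eq_zero]
    simp
  -- The lift `h` of `f ∘ g` satisfies `r h = 0` on `L`, so `h ∘ j` factors through `L/rL`, a direct
  -- summand of `G/rG`. The resulting extension `θ` to `G` is killed by `r`; hence `h - θ` descends
  -- to `K` and still divides `f`.
  obtain ⟨h', hh''⟩ := LinearMap.exists_comp_eq_of_surjective
    (TensorProduct.mk R Q L 1) (mk_one_quotient_span_singleton_surjective r _)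
    (h ∘ₗ j) fun x hx ↦ by
      obtain ⟨y, rfl⟩ := (one_tmul_quotient_span_singleton_eq_zero_iff r x).1 hx
      simp only [LinearMap.comp_apply, map_smul, hh']
      rw [hj.apply_apply_eq_zero, map_zero]
  let θ : G →ₗ[R] C := h' ∘ₗ ρ.restrictScalars R ∘ₗ TensorProduct.mk R Q _ 1
  have hθ (l : L) : θ (j l) = h (j l) := by
    have := LinearMap.congr_fun hh'' l
    simp only [LinearMap.comp_apply, TensorProduct.mk_apply] at this
    simp [θ, hρ', this]
  have hθ' (x) : r • θ x = 0 := by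
    change r • h' (ρ (1 ⊗ₜ x)) = 0
    rw [← map_smul h', smul_quotient_span_singleton_tmul_eq_zero, map_zero]
  obtain ⟨k, hk⟩ := LinearMap.exists_comp_eq_of_surjective g hg (h - θ) fun x hx ↦ by
    obtain ⟨l, rfl⟩ := (hj x).1 hx
    simp [hθ]
  refine ⟨k, LinearMap.ext fun x ↦ ?_⟩
  obtain ⟨y, rfl⟩ := hg x
  have : k (g y) = h y - θ y := LinearMap.congr_fun hk y
  simp [this, smul_sub, hθ', hh']

end QuotientByElement

/-! ### The module `Hom(R[r⁻¹], C)` and its contraadjustedness. -/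

section Divisible

variable {R : Type*} [CommRing R] (r : R) (C : Type*) [AddCommGroup C] [Module R C]

/-- The sequences `d` in `C` with `d n = r • d (n + 1)`, i.e. the homomorphisms `R[r⁻¹] → C`. -/
def divisibleSequences : Submodule R (ℕ → C) where
  carrier := {d | ∀ n, d n = r • d (n + 1)}
  zero_mem' := by simp
  add_mem' := by
    intro a b ha hb n
    simp [ha n, hb n]
  smul_mem' := by
    intro c a ha n
    rw [Pi.smul_apply, ha n, Pi.smul_apply, smul_comm]

variable {r C}

theorem divisibleSequences_eq_pow_smul (d : divisibleSequences r C) (n m : ℕ) :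
    d.1 n = r ^ m • d.1 (n + m) := by
  induction m with
  | zero => simp
  | succ m ih => rw [ih, d.2 (n + m), smul_smul, ← pow_succ, add_assoc]

theorem divisibleSequences_smul_bijective :
    Function.Bijective (fun d : divisibleSequences r C ↦ r • d) := by
  constructor
  · intro d e h
    ext n
    have := congrFun (congrArg Subtype.val h) (n + 1)
    simpa [← d.2 n, ← e.2 n] using this
  · intro d
    refine ⟨⟨fun n ↦ d.1 (n + 1), fun n ↦ d.2 (n + 1)⟩, ?_⟩
    ext n
    exact (d.2 n).symm

/-- Formally the solution is `e_n = ∑ t^k d_{n+k}`. Its `n`-th entry would be `∑ (rt)^k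
d_{n+k}(n+k)`, which solves the equation for `rt` along the diagonal; `a n` takes the place of this
infinite sum. -/
theorem IsSeqContraadjusted.divisibleSequences {t : R} (h : IsSeqContraadjusted (r * t) C) :
    IsSeqContraadjusted t (divisibleSequences r C) := by
  intro d
  obtain ⟨a, ha⟩ := h fun n ↦ (d n).1 n
  -- `E n m` plays the role of the entry of `e_n` at index `n + m`; the tail of the series is
  -- replaced by `t ^ m • a (n + m)`.
  let E : ℕ → ℕ → C := fun n m ↦
    ∑ k ∈ Finset.range m, t ^ k • (d (n + k)).1 (n + m) + t ^ m • a (n + m)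
  have hE (n m : ℕ) : E n m = r • E n (m + 1) := by
    have h1 (k : ℕ) : (d (n + k)).1 (n + m) = r • (d (n + k)).1 (n + (m + 1)) :=
      (d (n + k)).2 (n + m)
    have h2 : a (n + m) = (d (n + m)).1 (n + m) + (r * t) • a (n + (m + 1)) := by
      rw [← ha (n + m), add_assoc, sub_add_cancel]
    simp only [E, Finset.sum_range_succ, smul_add, Finset.smul_sum]
    simp only [h1, h2, smul_add, smul_smul]
    rw [add_assoc, pow_succ]
    congr 1
    · exact Finset.sum_congr rfl fun k _ ↦ by rw [mul_comm]
    · congr 2 <;> ring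
  have hE' (n m : ℕ) : E n (m + 1) = (d n).1 (n + (m + 1)) + t • E (n + 1) m := by
    have h2 (k : ℕ) : n + 1 + k = n + (k + 1) := by ring
    simp only [E, Finset.sum_range_succ', smul_add, Finset.smul_sum, h2, smul_smul, ← pow_succ',
      pow_zero, one_smul, add_zero]
    abel
  -- The factor `r ^ n` moves from index `n + m` back to index `m`.
  refine ⟨fun n ↦ ⟨fun m ↦ r ^ n • E n m, fun m ↦ ?_⟩, fun n ↦ Subtype.ext (funext fun m ↦ ?_)⟩
  · simp only
    rw [hE n m, smul_comm]
  · have h1 := divisibleSequences_eq_pow_smul (d n) m (n + 1)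
    rw [show m + (n + 1) = n + (m + 1) by ring] at h1
    simp only [Submodule.coe_sub, Submodule.coe_smul, Pi.sub_apply, Pi.smul_apply]
    rw [hE n m, hE' n m, h1, smul_add, smul_add, smul_smul, smul_smul, smul_smul, smul_smul,
      ← pow_succ, mul_comm t]
    abel

/-- When `r` already acts bijectively, the identity of `D` is a localization at `r`. -/
theorem mk_one_away_bijective {D : Type*} [AddCommGroup D] [Module R D]
    (h : Function.Bijective (fun d : D ↦ r • d)) :
    Function.Bijective (TensorProduct.mk R (Localization.Away r) D 1) := by
  have h1 : IsLocalizedModule (Submonoid.powers r) (LinearMap.id : D →ₗ[R] D) := by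
    refine ⟨?_, fun y ↦ ⟨(y, 1), by simp⟩, fun {x y} h ↦ ⟨1, by simpa using h⟩⟩
    rintro ⟨_, n, rfl⟩
    rw [map_pow]
    exact ((Module.End.isUnit_iff _).2 h).pow n
  have h2 : IsLocalizedModule (Submonoid.powers r)
      (TensorProduct.mk R (Localization.Away r) D 1) :=
    (isLocalizedModule_iff_isBaseChange (Submonoid.powers r) (Localization.Away r) _).2
      (TensorProduct.isBaseChange R D (Localization.Away r))
  have h3 := IsLocalizedModule.linearEquiv_apply (Submonoid.powers r) LinearMap.id
    (TensorProduct.mk R (Localization.Away r) D 1)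
  convert (IsLocalizedModule.linearEquiv (Submonoid.powers r) (LinearMap.id : D →ₗ[R] D)
    (TensorProduct.mk R (Localization.Away r) D 1)).bijective using 1
  ext x
  exact (h3 x).symm

/-- Rescaling the `n`-th term by `y ^ n` absorbs the unit. -/
theorem IsSeqContraadjusted.of_unit_mul {a : R} (y : Rˣ) (h : IsSeqContraadjusted (a * y) C) :
    IsSeqContraadjusted a C := by
  intro c
  obtain ⟨b, hb⟩ := h fun n ↦ ((y⁻¹ ^ n : Rˣ) : R) • c n
  refine ⟨fun n ↦ ((y ^ n : Rˣ) : R) • b n, fun n ↦ ?_⟩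
  have := congrArg (fun z ↦ ((y ^ n : Rˣ) : R) • z) (hb n)
  simp only [smul_sub, smul_smul] at this
  rw [← Units.val_mul, ← mul_pow, mul_inv_cancel, one_pow, Units.val_one, one_smul] at this
  rw [← this, smul_smul, pow_succ, Units.val_mul]
  congr 2
  ring

theorem IsSeqContraadjusted.map_algebraMap {R' : Type*} [CommRing R'] [Algebra R R'] [Module R' C]
    [IsScalarTower R R' C] {a : R} (h : IsSeqContraadjusted a C) :
    IsSeqContraadjusted (algebraMap R R' a) C := by
  simpa only [IsSeqContraadjusted, algebraMap_smul] using h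

end Divisible

/-! ### Gluing very flatness along `R/r` and `R[r⁻¹]`. -/

section Gluing

variable {R : Type*} [CommRing R] {r : R}

theorem IsSeqContraadjusted.of_isLocalizationAway {C : Type*} [AddCommGroup C] [Module R C]
    [Module (Localization.Away r) C] [IsScalarTower R (Localization.Away r) C]
    (x : Localization.Away r)
    (h : IsSeqContraadjusted (IsLocalization.Away.sec r x).1 C) : IsSeqContraadjusted x C := by
  have h1 := IsLocalization.Away.sec_spec r x
  have h2 : IsUnit (algebraMap R (Localization.Away r) (r ^ (IsLocalization.Away.sec r x).2)) := by
    rw [map_pow]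
    exact (IsLocalization.Away.algebraMap_isUnit r).pow _
  obtain ⟨y, hy⟩ := h2
  refine IsSeqContraadjusted.of_unit_mul y ?_
  rw [hy, h1]
  exact h.map_algebraMap

/-- For `P` projective, the group of homomorphisms `P → C` inherits contraadjustedness from `C`. -/
theorem IsSeqContraadjusted.hom_of_projective {C : Type*} [AddCommGroup C] [Module R C]
    (h : IsSeqContraadjusted r C) (P : Type*) [AddCommGroup P] [Module R P]
    [Module.Projective R P] : IsSeqContraadjusted r (P →ₗ[R] C) := by
  intro ψ
  obtain ⟨σ, hσ⟩ := Module.projective_lifting_property (Finsupp.linearCombination R (id : P → P))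
    LinearMap.id linearCombination_id_surjective
  choose b hb using fun x : P ↦ h fun n ↦ ψ n x
  have hb' (n : ℕ) : Finsupp.linearCombination R (fun x ↦ b x n) -
      r • Finsupp.linearCombination R (fun x ↦ b x (n + 1)) =
      ψ n ∘ₗ Finsupp.linearCombination R (id : P → P) := by
    ext x
    simp [hb]
  refine ⟨fun n ↦ Finsupp.linearCombination R (fun x ↦ b x n) ∘ₗ σ, fun n ↦ ?_⟩
  rw [← LinearMap.smul_comp, ← LinearMap.sub_comp, hb', LinearMap.comp_assoc, hσ,
    LinearMap.comp_id]

theorem exists_extension_add_smul {F C K P : Type*} [AddCommGroup F] [Module R F] [Module.Flat R F]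
    [AddCommGroup C] [Module R C] [AddCommGroup K] [Module R K] [AddCommGroup P] [Module R P]
    [Module.Projective R P] {i : K →ₗ[R] P} {p : P →ₗ[R] F}
    (hi : Function.Injective i) (hp : Function.Surjective p) (he : Function.Exact i p)
    (hF : ExtVanishes (R ⧸ Ideal.span {r}) ((R ⧸ Ideal.span {r}) ⊗[R] F)
      ((R ⧸ Ideal.span {r}) ⊗[R] C))
    (hK : Module.Projective (R ⧸ Ideal.span {r}) ((R ⧸ Ideal.span {r}) ⊗[R] K))
    (φ : K →ₗ[R] C) : ∃ (ψ : P →ₗ[R] C) (φ' : K →ₗ[R] C), φ = ψ ∘ₗ i + r • φ' := by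
  let Q := R ⧸ Ideal.span {r}
  have : Module.Flat R K := Module.Flat.of_exact hi hp he
  have hi' : Function.Injective (i.baseChange Q) :=
    Module.Flat.lTensor_injective_of_exact hi hp he Q
  have hp' : Function.Surjective (p.baseChange Q) := LinearMap.lTensor_surjective Q hp
  have he' : Function.Exact (i.baseChange Q) (p.baseChange Q) := lTensor_exact Q he hp
  obtain ⟨Ψ, hΨ⟩ := (extVanishes_iff hi' hp' he').1 hF (φ.baseChange Q)
  obtain ⟨ψ, hψ⟩ := Module.projective_lifting_property (TensorProduct.mk R Q C 1)
    (Ψ.restrictScalars R ∘ₗ TensorProduct.mk R Q P 1)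
    (mk_one_quotient_span_singleton_surjective r C)
  obtain ⟨φ', hφ'⟩ := exists_smul_eq_of_projective_quotient r (φ - ψ ∘ₗ i) fun x ↦ by
    rw [← one_tmul_quotient_span_singleton_eq_zero_iff]
    have h1 : (1 : Q) ⊗ₜ[R] ψ (i x) = Ψ (1 ⊗ₜ i x) := LinearMap.congr_fun hψ (i x)
    have h2 := LinearMap.congr_fun hΨ (1 ⊗ₜ x)
    simp only [LinearMap.comp_apply, LinearMap.baseChange_tmul] at h2
    rw [LinearMap.sub_apply, tmul_sub, LinearMap.comp_apply, h1, h2, sub_self]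
  exact ⟨ψ, φ', by rw [← hφ']; abel⟩

theorem exists_extension_of_eq_smul_succ {F C K P : Type*} [AddCommGroup F] [Module R F]
    [AddCommGroup C] [Module R C] [AddCommGroup K] [Module R K] [AddCommGroup P] [Module R P]
    [Module.Projective R P] {i : K →ₗ[R] P} {p : P →ₗ[R] F}
    (hi : Function.Injective i) (hp : Function.Surjective p) (he : Function.Exact i p)
    (hF : ExtVanishes (Localization.Away r) (Localization.Away r ⊗[R] F)
      (Localization.Away r ⊗[R] divisibleSequences r C))
    (γ : ℕ → K →ₗ[R] C) (hγ : ∀ n, γ n = r • γ (n + 1)) :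
    ∃ ψ : P →ₗ[R] C, ψ ∘ₗ i = γ 0 := by
  let A := Localization.Away r
  have hi' : Function.Injective (i.baseChange A) :=
    Module.Flat.lTensor_preserves_injective_linearMap i hi
  have hp' : Function.Surjective (p.baseChange A) := LinearMap.lTensor_surjective A hp
  have he' : Function.Exact (i.baseChange A) (p.baseChange A) := lTensor_exact A he hp
  let Γ : K →ₗ[R] divisibleSequences r C :=
    (LinearMap.pi γ).codRestrict _ fun x n ↦ LinearMap.congr_fun (hγ n) x
  obtain ⟨Ψ, hΨ⟩ := (extVanishes_iff hi' hp' he').1 hF (Γ.baseChange A)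
  let e := LinearEquiv.ofBijective _
    (mk_one_away_bijective (D := divisibleSequences r C) divisibleSequences_smul_bijective)
  refine ⟨LinearMap.proj 0 ∘ₗ Submodule.subtype _ ∘ₗ e.symm.toLinearMap ∘ₗ
    Ψ.restrictScalars R ∘ₗ TensorProduct.mk R A P 1, LinearMap.ext fun x ↦ ?_⟩
  have h2 := LinearMap.congr_fun hΨ (1 ⊗ₜ x)
  simp only [LinearMap.comp_apply, LinearMap.baseChange_tmul] at h2
  have h3 : e.symm (Ψ (1 ⊗ₜ i x)) = Γ x := by
    rw [h2, LinearEquiv.symm_apply_eq]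
    rfl
  change (e.symm (Ψ (1 ⊗ₜ i x))).1 0 = _
  rw [h3]
  rfl

end Gluing

theorem exists_isSeqVeryFlat_of_quotient_of_away {R : Type u} [CommRing R] (r : R)
    (F : Type (max u v)) [AddCommGroup F] [Module R F] [Module.Flat R F]
    (hQ : ∃ s : Finset (R ⧸ Ideal.span {r}),
      IsSeqVeryFlat.{u, v} s ((R ⧸ Ideal.span {r}) ⊗[R] F))
    (hA : ∃ s : Finset (Localization.Away r),
      IsSeqVeryFlat.{u, v} s (Localization.Away r ⊗[R] F)) :
    ∃ s : Finset R, IsSeqVeryFlat.{u, v} s F := by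
  classical
  obtain ⟨s, hs⟩ := hQ
  obtain ⟨t, ht⟩ := hA
  let Q := R ⧸ Ideal.span {r}
  choose σ hσ using Ideal.Quotient.mk_surjective (I := Ideal.span {r})
  -- The finite set: `r` itself, lifts of `s`, and for each `x ∈ t` a numerator times `r`, the extra
  -- `r` being what `IsSeqContraadjusted.divisibleSequences` consumes.
  refine ⟨insert r (s.image σ ∪ t.image fun x ↦ r * (IsLocalization.Away.sec r x).1),
    fun C _ _ hC ↦ ?_⟩
  have hr : IsSeqContraadjusted r C := hC r (by simp)
  have hF : ExtVanishes Q (Q ⊗[R] F) (Q ⊗[R] C) := hs _ fun x hx ↦ by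
    have h1 : IsSeqContraadjusted (σ x) (Q ⊗[R] C) :=
      (hC (σ x) (by simp only [Finset.mem_insert, Finset.mem_union, Finset.mem_image]; grind)
        ).of_surjective _ (mk_one_quotient_span_singleton_surjective r C)
    have := h1.map_algebraMap (R' := Q)
    rwa [Ideal.Quotient.algebraMap_eq, hσ] at this
  have hF' : ExtVanishes (Localization.Away r) (Localization.Away r ⊗[R] F)
      (Localization.Away r ⊗[R] divisibleSequences r C) := ht _ fun x hx ↦ by
    refine .of_isLocalizationAway x ?_
    refine IsSeqContraadjusted.of_surjective _
      (mk_one_away_bijective (D := divisibleSequences r C) divisibleSequences_smul_bijective).2 ?_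
    refine (hC _ ?_).divisibleSequences
    simp only [Finset.mem_insert, Finset.mem_union, Finset.mem_image]
    exact .inr (.inr ⟨x, hx, rfl⟩)
  obtain ⟨K, P, _, _, _, _, _, i, p, hi, hp, he⟩ := exists_projective_presentation R F
  have hK : Module.Projective Q (Q ⊗[R] K) :=
    hs.projective_syzygy (i := i.baseChange Q) (p := p.baseChange Q)
      (Module.Flat.lTensor_injective_of_exact hi hp he Q) (LinearMap.lTensor_surjective Q hp)
      (lTensor_exact Q he hp)
  rw [extVanishes_iff hi hp he]
  intro φ
  choose ψ φ' hψ using exists_extension_add_smul (C := C) hi hp he hF hK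
  let φs : ℕ → K →ₗ[R] C := fun n ↦ φ'^[n] φ
  have hφs (n : ℕ) : φs n = ψ (φs n) ∘ₗ i + r • φs (n + 1) := by
    simp only [φs, Function.iterate_succ_apply']
    exact hψ _
  -- This replaces the possibly meaningless sum `∑ r^n ψ_n`; the remaining error is infinitely
  -- `r`-divisible in a compatible way.
  obtain ⟨β, hβ⟩ := hr.hom_of_projective P fun n ↦ ψ (φs n)
  obtain ⟨χ, hχ⟩ := exists_extension_of_eq_smul_succ hi hp he hF'
    (fun n ↦ φs n - β n ∘ₗ i) fun n ↦ by
      rw [hφs n, ← hβ n, LinearMap.sub_comp, smul_sub, LinearMap.smul_comp]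
      abel
  refine ⟨β 0 + χ, ?_⟩
  change (β 0 + χ) ∘ₗ i = φs 0
  rw [LinearMap.add_comp, hχ]
  abel

/-! ### Projectivity from a filtration. -/

section Filtration

variable {R : Type*} [CommRing R] (A : Type*) [CommRing A] [Algebra R A] [Module.Flat R A]
  {W M : Type*} [AddCommGroup W] [Module R W] [AddCommGroup M] [Module R M]
  {G : ℕ → Type*} [∀ n, AddCommGroup (G n)] [∀ n, Module R (G n)]

/-- A module exhausted by an increasing sequence of submodules is projective after a flat base
change if the successive quotients are. -/
theorem projective_baseChange_of_filtration (u : ℕ → W →ₗ[R] M) (N : ℕ → Submodule R M)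
    (h0 : N 0 = ⊥) (hsucc : ∀ n, N (n + 1) = N n ⊔ LinearMap.range (u n))
    (hN : ∀ x, ∃ n, x ∈ N n) (π : ∀ n, W →ₗ[R] G n) (hπ : ∀ n, Function.Surjective (π n))
    (hker : ∀ n w, π n w = 0 ↔ u n w ∈ N n)
    (hproj : ∀ n, Module.Projective A (A ⊗[R] G n)) : Module.Projective A (A ⊗[R] M) := by
  classical
  have hπ' (n) : Function.Surjective ((π n).baseChange A) := LinearMap.lTensor_surjective A (hπ n)
  choose σ hσ using fun n ↦
    Module.projective_lifting_property ((π n).baseChange A) LinearMap.id (hπ' n)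
  replace hσ (n x) : (π n).baseChange A (σ n x) = x := LinearMap.congr_fun (hσ n) x
  -- The splittings `σ n` of the graded pieces identify `A ⊗ M` with the direct sum of the `A ⊗ G
  -- n`.
  let g : (Π₀ n, A ⊗[R] G n) →ₗ[A] A ⊗[R] M :=
    DFinsupp.lsum ℕ fun n ↦ (u n).baseChange A ∘ₗ σ n
  have hg (n x) : g (DFinsupp.single n x) = (u n).baseChange A (σ n x) := by
    simp [g]
  have hex (n : ℕ) : Function.Exact ((N n).subtype.baseChange A) ((N n).mkQ.baseChange A) :=
    lTensor_exact A (LinearMap.exact_subtype_mkQ (N n)) (N n).mkQ_surjective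
  have hmono (n) : LinearMap.ker ((N n).mkQ.baseChange A) ≤
      LinearMap.ker ((N (n + 1)).mkQ.baseChange A) := fun x hx ↦ by
    obtain ⟨y, rfl⟩ := (hex n x).1 hx
    have : (N (n + 1)).mkQ ∘ₗ (N n).subtype = 0 := by
      ext z
      have : (z : M) ∈ N (n + 1) := by
        rw [hsucc]
        exact Submodule.mem_sup_left z.2
      simpa using this
    rw [LinearMap.mem_ker, ← LinearMap.comp_apply, ← LinearMap.baseChange_comp, this]
    simp
  have hu (n) : LinearMap.range ((u n).baseChange A) ≤
      LinearMap.ker ((N (n + 1)).mkQ.baseChange A) := by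
    rintro _ ⟨y, rfl⟩
    have : (N (n + 1)).mkQ ∘ₗ u n = 0 := by
      ext z
      have : u n z ∈ N (n + 1) := by
        rw [hsucc]
        exact Submodule.mem_sup_right ⟨z, rfl⟩
      simpa using this
    rw [LinearMap.mem_ker, ← LinearMap.comp_apply, ← LinearMap.baseChange_comp, this]
    simp
  have key (n : ℕ) : ∀ x, (∀ m, n ≤ m → x m = 0) →
      (N n).mkQ.baseChange A (g x) = 0 ∧ (g x = 0 → x = 0) := by
    induction n with
    | zero =>
      intro x hx
      have : x = 0 := by
        ext m : 1
        exact hx m (Nat.zero_le m)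
      simp [this]
    | succ n ih =>
      intro x hx
      obtain ⟨h1, h2⟩ := ih (x.erase n) fun m hm ↦ by
        rcases hm.eq_or_lt with rfl | hm
        · simp
        · rw [DFinsupp.erase_ne hm.ne', hx m hm]
      have hx' : x = x.erase n + DFinsupp.single n (x n) := (DFinsupp.erase_add_single n x).symm
      have hgx : g x = g (x.erase n) + (u n).baseChange A (σ n (x n)) := by
        conv_lhs => rw [hx', map_add, hg]
      refine ⟨?_, fun h ↦ ?_⟩
      · rw [hgx, map_add, hmono n h1, hu n ⟨_, rfl⟩, add_zero]
      -- `G n` embeds into `M / N n`, and flatness of `A` keeps this injective; so the top component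
      -- of an element of the kernel of `g` vanishes.
      · obtain ⟨v, hv⟩ := LinearMap.exists_comp_eq_of_surjective (π n) (hπ n) ((N n).mkQ ∘ₗ u n)
          fun w hw ↦ by simpa using (hker n w).1 hw
        have hvinj : Function.Injective v := by
          rw [injective_iff_map_eq_zero]
          intro y hy
          obtain ⟨w, rfl⟩ := hπ n y
          have h3 : v (π n w) = (N n).mkQ (u n w) := LinearMap.congr_fun hv w
          rw [h3] at hy
          exact (hker n w).2 (by simpa using hy)
        have hxn : x n = 0 := by
          apply Module.Flat.lTensor_preserves_injective_linearMap (M := A) v hvinj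
          change v.baseChange A (x n) = v.baseChange A 0
          rw [map_zero]
          conv_lhs => rw [← hσ n (x n)]
          rw [← LinearMap.comp_apply, ← LinearMap.baseChange_comp, hv, LinearMap.baseChange_comp,
            LinearMap.comp_apply]
          have h4 := congrArg ((N n).mkQ.baseChange A) hgx
          rwa [h, map_add, h1, zero_add, map_zero, eq_comm] at h4
        rw [hxn, DFinsupp.single_zero, add_zero] at hx'
        rw [hxn, map_zero, map_zero, add_zero] at hgx
        rw [hx']
        exact h2 (hgx.symm.trans h)
  have hinj : Function.Injective g := by
    rw [injective_iff_map_eq_zero]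
    intro x hx
    refine (key (x.support.sup id + 1) x fun m hm ↦ ?_).2 hx
    by_contra h
    have := Finset.le_sup (f := id) (DFinsupp.mem_support_iff.2 h)
    simp only [id] at this
    omega
  have hrange (n : ℕ) : LinearMap.range ((N n).subtype.baseChange A) ≤ LinearMap.range g := by
    induction n with
    | zero =>
      have : (N 0).subtype = 0 := by
        ext z
        have := z.2
        simpa [h0] using this
      rw [this]
      simp
    | succ n ih =>
      have h1 : LinearMap.range ((u n).baseChange A) ≤ LinearMap.range g := by
        rintro _ ⟨y, rfl⟩
        have h2 : Function.Exact ((LinearMap.ker (π n)).subtype.baseChange A)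
            ((π n).baseChange A) :=
          lTensor_exact A (LinearMap.exact_subtype_ker_map (π n)) (hπ n)
        -- The difference comes from `ker (π n)`, which `u n` sends into `N n`, where the induction
        -- hypothesis applies.
        obtain ⟨z, hz⟩ := (h2 (y - σ n ((π n).baseChange A y))).1 (by
          rw [map_sub, hσ, sub_self])
        rw [sub_eq_iff_eq_add.1 hz.symm, map_add, ← hg n]
        refine add_mem (ih ?_) ⟨_, rfl⟩
        refine (hex n _).1 ?_
        have h3 : (N n).mkQ ∘ₗ u n ∘ₗ (LinearMap.ker (π n)).subtype = 0 := by
          ext w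
          have := (hker n w).1 w.2
          simpa using this
        rw [← LinearMap.comp_apply, ← LinearMap.comp_apply, LinearMap.comp_assoc,
          ← LinearMap.baseChange_comp, ← LinearMap.baseChange_comp, h3]
        simp
      rintro _ ⟨y, rfl⟩
      induction y with
      | zero => simp
      | add y z hy hz => rw [map_add]; exact add_mem hy hz
      | tmul a x =>
        obtain ⟨y, hy, _, ⟨z, rfl⟩, hyz⟩ := Submodule.mem_sup.1 ((hsucc n).le x.2)
        rw [LinearMap.baseChange_tmul, Submodule.subtype_apply, ← hyz, tmul_add]
        exact add_mem (ih ⟨a ⊗ₜ ⟨y, hy⟩, by simp⟩) (h1 ⟨a ⊗ₜ z, by simp⟩)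
  have hsurj : Function.Surjective g := by
    intro x
    induction x with
    | zero => exact ⟨0, map_zero g⟩
    | add x y hx hy =>
      obtain ⟨x, rfl⟩ := hx
      obtain ⟨y, rfl⟩ := hy
      exact ⟨x + y, map_add g x y⟩
    | tmul a m =>
      obtain ⟨n, hn⟩ := hN m
      exact hrange n ⟨a ⊗ₜ ⟨m, hn⟩, by simp⟩
  exact Module.Projective.of_equiv (LinearEquiv.ofBijective g ⟨hinj, hsurj⟩)

end Filtration

/-! ### Generic projectivity over polynomial rings. -/

section Generic

theorem projective_tensor_of_isUnit {R : Type*} [CommRing R] (f : R) {M : Type*} [AddCommGroup M]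
    [Module R M] [Module.Projective (Localization.Away f) (Localization.Away f ⊗[R] M)]
    (A : Type*) [CommRing A] [Algebra R A] (hf : IsUnit (algebraMap R A f)) :
    Module.Projective A (A ⊗[R] M) := by
  let _ : Algebra (Localization.Away f) A := (IsLocalization.Away.lift f hf).toAlgebra
  have : IsScalarTower R (Localization.Away f) A := .of_algebraMap_eq fun x ↦
    (IsLocalization.Away.lift_eq f hf x).symm
  exact Module.Projective.of_equiv
    (AlgebraTensorModule.cancelBaseChange R (Localization.Away f) A A M)

/-- Every finite `B`-module becomes projective over the localization of `A` at some nonzero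
element. -/
def IsGenericallyProjective (A : Type u) (B : Type w) [CommRing A] [CommRing B] [Algebra A B] :
    Prop :=
  ∀ (M : Type v) [AddCommGroup M] [Module A M] [Module B M] [IsScalarTower A B M]
    [Module.Finite B M],
    ∃ f : A, f ≠ 0 ∧ Module.Projective (Localization.Away f) (Localization.Away f ⊗[A] M)

variable {A : Type u} [CommRing A]

/-- Over the fraction field the module is free, and by finite presentation this spreads out to some
`f ≠ 0`. -/
theorem isGenericallyProjective_of_finite [IsDomain A] [IsNoetherianRing A] (B : Type*) [CommRing B]
    [Algebra A B] [Module.Finite A B] : IsGenericallyProjective.{u, v} A B := by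
  intro M _ _ _ _ _
  have : Module.Finite A M := Module.Finite.trans B M
  have : Module.FinitePresentation A M := Module.finitePresentation_of_finite A M
  let S := nonZeroDivisors A
  obtain ⟨f, hf, h, -⟩ := Module.FinitePresentation.exists_free_localizedModule_powers S
    (LocalizedModule.mkLinearMap S M) (FractionRing A)
  refine ⟨f, nonZeroDivisors.ne_zero hf, ?_⟩
  exact Module.Projective.of_equiv (LocalizedModule.equivTensorProduct (Submonoid.powers f) M)

theorem IsGenericallyProjective.of_algEquiv {B B' : Type*} [CommRing B] [CommRing B'] [Algebra A B]
    [Algebra A B'] (e : B ≃ₐ[A] B') (h : IsGenericallyProjective.{u, v} A B) :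
    IsGenericallyProjective.{u, v} A B' := by
  intro M _ _ _ _ _
  let _ : Module B M := Module.compHom M e.toRingEquiv.toRingHom
  have hsmul (b : B) (m : M) : b • m = e b • m := rfl
  have : IsScalarTower A B M := ⟨fun a b m ↦ by simp [hsmul]⟩
  have : Module.Finite B M := by
    obtain ⟨s, hs⟩ := Module.Finite.fg_top (R := B') (M := M)
    refine ⟨s, ?_⟩
    rw [eq_top_iff]
    intro x _
    have hx : x ∈ Submodule.span B' (s : Set M) := hs ▸ Submodule.mem_top
    induction hx using Submodule.span_induction with
    | mem x hx => exact Submodule.subset_span hx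
    | zero => exact zero_mem _
    | add x y _ _ hx hy => exact add_mem (hx trivial) (hy trivial)
    | smul b x _ hx =>
      have := Submodule.smul_mem (Submodule.span B (s : Set M)) (e.symm b) (hx trivial)
      rwa [hsmul, e.apply_symm_apply] at this
  exact h M

-- Filter `M` by `N n = ∑_{i<n} X^i M₀` with `M₀` the `B`-span of generators. The graded pieces are
-- quotients `M₀ / K n` with `K n` increasing, so only finitely many occur and one product of
-- denominators serves them all.
open Polynomial in
theorem exists_projective_away_of_finite_polynomial [IsDomain A] {B : Type*} [CommRing B] [IsNoetherianRing B]
    [Algebra A B] (h : IsGenericallyProjective.{u, v} A B) (M : Type v) [AddCommGroup M]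
    [Module A M] [Module B M] [Module B[X] M] [IsScalarTower A B M] [IsScalarTower B B[X] M]
    [Module.Finite B[X] M] :
    ∃ f : A, f ≠ 0 ∧ Module.Projective (Localization.Away f) (Localization.Away f ⊗[A] M) := by
  classical
  obtain ⟨s, hs⟩ := Module.Finite.fg_top (R := B[X]) (M := M)
  let M₀ := Submodule.span B (s : Set M)
  have : Module.Finite B M₀ := Module.Finite.span_of_finite B s.finite_toSet
  let u (n : ℕ) : M₀ →ₗ[B] M := Algebra.lsmul B B M (X ^ n : B[X]) ∘ₗ M₀.subtype
  have hu (n m) : u n m = (X ^ n : B[X]) • (m : M) := rfl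
  obtain ⟨N, h0, hsucc⟩ : ∃ N : ℕ → Submodule B M, N 0 = ⊥ ∧
      ∀ n, N (n + 1) = N n ⊔ LinearMap.range (u n) :=
    ⟨fun n ↦ n.rec ⊥ fun n N ↦ N ⊔ LinearMap.range (u n), rfl, fun _ ↦ rfl⟩
  have hmono : Monotone N := monotone_nat_of_le_succ fun n ↦ by rw [hsucc]; exact le_sup_left
  have hX (n) : ∀ x ∈ N n, (X : B[X]) • x ∈ N (n + 1) := by
    induction n with
    | zero =>
      intro x hx
      have : x = 0 := by simpa [h0] using hx
      simp [this]
    | succ n ih =>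
      intro x hx
      rw [hsucc, Submodule.mem_sup] at hx
      obtain ⟨y, hy, _, ⟨z, rfl⟩, rfl⟩ := hx
      rw [smul_add]
      refine add_mem (hmono (Nat.le_succ _) (ih y hy)) ?_
      rw [hsucc]
      exact Submodule.mem_sup_right ⟨z, by rw [hu, hu, smul_smul, pow_succ']⟩
  let K : ℕ →o Submodule B M₀ :=
    ⟨fun n ↦ (N n).comap (u n), monotone_nat_of_le_succ fun n x hx ↦ by
      have := hX n _ hx
      rw [Submodule.mem_comap, hu, pow_succ', ← smul_smul]
      exact this⟩
  obtain ⟨n₀, hn₀⟩ := monotone_stabilizes_iff_noetherian.2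
    (inferInstanceAs (IsNoetherian B M₀)) K
  choose f hf0 hf using fun n ↦ h (M₀ ⧸ K n)
  refine ⟨∏ n ∈ Finset.range (n₀ + 1), f n, Finset.prod_ne_zero_iff.2 fun n _ ↦ hf0 n, ?_⟩
  refine projective_baseChange_of_filtration _ (fun n ↦ (u n).restrictScalars A)
    (fun n ↦ (N n).restrictScalars A) (by simp [h0]) (fun n ↦ ?_) (fun x ↦ ?_)
    (fun n ↦ (K n).mkQ.restrictScalars A) (fun n ↦ (K n).mkQ_surjective) (fun n w ↦ ?_) fun n ↦ ?_
  · ext x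
    simp [hsucc, Submodule.mem_sup]
  · have hx : x ∈ Submodule.span B[X] (s : Set M) := hs ▸ Submodule.mem_top
    simp only [Submodule.restrictScalars_mem]
    induction hx using Submodule.span_induction with
    | mem x hx =>
      refine ⟨1, ?_⟩
      rw [hsucc]
      exact Submodule.mem_sup_right ⟨⟨x, Submodule.subset_span hx⟩, by simp [hu]⟩
    | zero => exact ⟨0, zero_mem _⟩
    | add x y _ _ hx hy =>
      obtain ⟨n, hx⟩ := hx
      obtain ⟨m, hy⟩ := hy
      exact ⟨max n m, add_mem (hmono (le_max_left _ _) hx) (hmono (le_max_right _ _) hy)⟩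
    | smul b x _ hx =>
      induction b using Polynomial.induction_on with
      | C b =>
        obtain ⟨n, hx⟩ := hx
        exact ⟨n, by simpa [← algebraMap_smul B[X] b x] using (N n).smul_mem b hx⟩
      | add p q hp hq =>
        obtain ⟨n, hp⟩ := hp
        obtain ⟨m, hq⟩ := hq
        rw [add_smul]
        exact ⟨max n m, add_mem (hmono (le_max_left _ _) hp) (hmono (le_max_right _ _) hq)⟩
      | monomial n b ih =>
        obtain ⟨m, hm⟩ := ih
        refine ⟨m + 1, ?_⟩
        have := hX _ _ hm
        rwa [smul_smul, show X * (C b * X ^ n) = C b * X ^ (n + 1) by ring] at this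
  · simp [K]
  · have hn : ∃ m ≤ n₀, K n = K m := by
      rcases le_total n n₀ with h | h
      · exact ⟨n, h, rfl⟩
      · exact ⟨n₀, le_rfl, (hn₀ n h).symm⟩
    obtain ⟨m, hm, hnm⟩ := hn
    rw [hnm]
    have := hf m
    refine projective_tensor_of_isUnit (f m) _ (isUnit_of_dvd_unit (map_dvd _ ?_)
      (IsLocalization.Away.algebraMap_isUnit (∏ n ∈ Finset.range (n₀ + 1), f n)))
    exact Finset.dvd_prod_of_mem f (by simpa [Nat.lt_succ_iff] using hm)

open Polynomial in
theorem IsGenericallyProjective.polynomial [IsDomain A] {B : Type*} [CommRing B] [IsNoetherianRing B]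
    [Algebra A B] (h : IsGenericallyProjective.{u, v} A B) :
    IsGenericallyProjective.{u, v} A B[X] := by
  intro M _ _ _ _ _
  let _ : Module B M := Module.compHom M (C : B →+* B[X])
  have hsmul (b : B) (m : M) : b • m = (C b : B[X]) • m := rfl
  have : IsScalarTower A B M := ⟨fun a b m ↦ by
    rw [hsmul, hsmul, ← smul_assoc, Polynomial.smul_C]⟩
  have : IsScalarTower B B[X] M := ⟨fun b p m ↦ by
    rw [hsmul, smul_smul, Polynomial.smul_eq_C_mul]⟩
  exact exists_projective_away_of_finite_polynomial h M

theorem isGenericallyProjective_mvPolynomial [IsDomain A] [IsNoetherianRing A] (n : ℕ) :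
    IsGenericallyProjective.{u, v} A (MvPolynomial (Fin n) A) := by
  induction n with
  | zero =>
    exact (isGenericallyProjective_of_finite A).of_algEquiv (MvPolynomial.isEmptyAlgEquiv A _).symm
  | succ n ih => exact ih.polynomial.of_algEquiv (MvPolynomial.finSuccEquiv A n).symm

end Generic

/-! ### Noetherian induction on the base. -/

section Induction

theorem IsSeqVeryFlat.of_projective {R : Type u} [CommRing R] (F : Type (max u v)) [AddCommGroup F]
    [Module R F] [Module.Projective R F] : IsSeqVeryFlat.{u, v} (∅ : Finset R) F :=
  fun _ _ _ _ ↦ extVanishes_of_projective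

theorem exists_isSeqVeryFlat_baseChange_of_quotient_of_away {R₀ : Type u} [CommRing R₀]
    (F₀ : Type (max u v)) [AddCommGroup F₀] [Module R₀ F₀] {A : Type u} [CommRing A] [Algebra R₀ A]
    [Module.Flat A (A ⊗[R₀] F₀)] (r : A)
    (hQ : ∃ s : Finset (A ⧸ Ideal.span {r}),
      IsSeqVeryFlat.{u, v} s ((A ⧸ Ideal.span {r}) ⊗[R₀] F₀))
    (hL : ∃ s : Finset (Localization.Away r),
      IsSeqVeryFlat.{u, v} s (Localization.Away r ⊗[R₀] F₀)) :
    ∃ s : Finset A, IsSeqVeryFlat.{u, v} s (A ⊗[R₀] F₀) := by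
  obtain ⟨s, hs⟩ := hQ
  obtain ⟨t, ht⟩ := hL
  exact exists_isSeqVeryFlat_of_quotient_of_away r _
    ⟨s, hs.of_equiv (AlgebraTensorModule.cancelBaseChange R₀ A _ _ F₀).symm⟩
    ⟨t, ht.of_equiv (AlgebraTensorModule.cancelBaseChange R₀ A _ _ F₀).symm⟩

theorem Module.Flat.tensor_of_isScalarTower {R₀ : Type*} [CommRing R₀] (F₀ : Type*)
    [AddCommGroup F₀] [Module R₀ F₀] (A : Type*) [CommRing A] [Algebra R₀ A]
    [Module.Flat A (A ⊗[R₀] F₀)] (A' : Type*) [CommRing A'] [Algebra R₀ A'] [Algebra A A']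
    [IsScalarTower R₀ A A'] : Module.Flat A' (A' ⊗[R₀] F₀) :=
  .of_linearEquiv (AlgebraTensorModule.cancelBaseChange R₀ A A' A' F₀).symm

-- Generic projectivity over the domain `R₀ ⧸ I`, transported to every algebra over it in which `f`
-- is invertible.
attribute [local instance] MvPolynomial.algebraMvPolynomial in
theorem exists_notMem_projective_tensor {R₀ : Type u} [CommRing R₀] [IsNoetherianRing R₀] (n : ℕ)
    (F₀ : Type (max u v)) [AddCommGroup F₀] [Module R₀ F₀] [Module (MvPolynomial (Fin n) R₀) F₀]
    [IsScalarTower R₀ (MvPolynomial (Fin n) R₀) F₀] [Module.Finite (MvPolynomial (Fin n) R₀) F₀]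
    (I : Ideal R₀) [I.IsPrime] :
    ∃ f : R₀, f ∉ I ∧ ∀ (A : Type u) [CommRing A] [Algebra R₀ A],
      I ≤ RingHom.ker (algebraMap R₀ A) → IsUnit (algebraMap R₀ A f) →
        Module.Projective A (A ⊗[R₀] F₀) := by
  let A₀ := R₀ ⧸ I
  let e := Algebra.IsPushout.cancelBaseChange R₀ A₀ (MvPolynomial (Fin n) R₀)
    (MvPolynomial (Fin n) A₀) F₀
  obtain ⟨f, hf0, hf⟩ := isGenericallyProjective_mvPolynomial.{u, max u v} (A := A₀) n
    (MvPolynomial (Fin n) A₀ ⊗[MvPolynomial (Fin n) R₀] F₀)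
  obtain ⟨f, rfl⟩ := Ideal.Quotient.mk_surjective f
  refine ⟨f, fun h ↦ hf0 (Ideal.Quotient.eq_zero_iff_mem.2 h), fun A _ _ hI hA ↦ ?_⟩
  let _ : Algebra A₀ A := (Ideal.Quotient.lift I (algebraMap R₀ A) hI).toAlgebra
  have : IsScalarTower R₀ A₀ A := .of_algebraMap_eq fun _ ↦ rfl
  have h := projective_tensor_of_isUnit (Ideal.Quotient.mk I f)
    (M := MvPolynomial (Fin n) A₀ ⊗[MvPolynomial (Fin n) R₀] F₀) A hA
  exact .of_equiv (AlgebraTensorModule.congr (.refl A A) e ≪≫ₗ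
    AlgebraTensorModule.cancelBaseChange R₀ A₀ A A F₀)

/-- Each step cuts along one element of `R₀` outside `I`. Passing to the quotient of `A` always
enlarges `I`; after localization, either `I` is prime and the module is projective, or `ab ∈ I` and
inverting `a` kills `b`, enlarging `I` again. -/
theorem exists_isSeqVeryFlat_baseChange_of_le_ker {R₀ : Type u} [CommRing R₀] [IsNoetherianRing R₀]
    (n : ℕ) (F₀ : Type (max u v)) [AddCommGroup F₀] [Module R₀ F₀]
    [Module (MvPolynomial (Fin n) R₀) F₀] [IsScalarTower R₀ (MvPolynomial (Fin n) R₀) F₀]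
    [Module.Finite (MvPolynomial (Fin n) R₀) F₀] (I : Ideal R₀) :
    ∀ (A : Type u) [CommRing A] [Algebra R₀ A] [Module.Flat A (A ⊗[R₀] F₀)],
      I ≤ RingHom.ker (algebraMap R₀ A) →
        ∃ s : Finset A, IsSeqVeryFlat.{u, v} s (A ⊗[R₀] F₀) := by
  induction I using IsNoetherian.induction with
  | hgt I ih =>
    intro A _ _ _ hI
    have hquot (a : R₀) (ha : a ∉ I) : ∃ s : Finset (A ⧸ Ideal.span {algebraMap R₀ A a}),
        IsSeqVeryFlat.{u, v} s ((A ⧸ Ideal.span {algebraMap R₀ A a}) ⊗[R₀] F₀) := by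
      have := Module.Flat.tensor_of_isScalarTower (R₀ := R₀) F₀ A (A ⧸ Ideal.span {algebraMap R₀ A a})
      refine ih (I ⊔ Ideal.span {a}) (left_lt_sup.2 fun h ↦ ha (h (Ideal.mem_span_singleton_self a)))
        _ (sup_le (fun x hx ↦ ?_) ?_)
      · rw [RingHom.mem_ker, IsScalarTower.algebraMap_apply R₀ A (A ⧸ _), hI hx, map_zero]
      · rw [Ideal.span_singleton_le_iff_mem, RingHom.mem_ker,
          IsScalarTower.algebraMap_apply R₀ A (A ⧸ _)]
        exact Ideal.Quotient.eq_zero_iff_mem.2 (Ideal.mem_span_singleton_self _)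
    have haway (a : R₀) : I ≤ RingHom.ker (algebraMap R₀ (Localization.Away (algebraMap R₀ A a))) :=
      fun x hx ↦ by
        rw [RingHom.mem_ker, IsScalarTower.algebraMap_apply R₀ A (Localization.Away _), hI hx, map_zero]
    have hunit (a : R₀) : IsUnit (algebraMap R₀ (Localization.Away (algebraMap R₀ A a)) a) := by
      rw [IsScalarTower.algebraMap_apply R₀ A (Localization.Away _)]
      exact IsLocalization.Away.algebraMap_isUnit _
    by_cases hprime : Ideal.IsPrime I
    · obtain ⟨f, hf, h⟩ := exists_notMem_projective_tensor.{u, v} n F₀ I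
      have := h _ (haway f) (hunit f)
      exact exists_isSeqVeryFlat_baseChange_of_quotient_of_away F₀ _ (hquot f hf)
        ⟨∅, .of_projective _⟩
    · rw [Ideal.isPrime_iff] at hprime
      by_cases htop : I = ⊤
      · have h1 : (1 : A) = 0 := by
          have : (1 : R₀) ∈ RingHom.ker (algebraMap R₀ A) := hI (htop ▸ Submodule.mem_top)
          simpa using this
        have := subsingleton_of_zero_eq_one h1.symm
        have := Module.subsingleton A (A ⊗[R₀] F₀)
        exact ⟨∅, .of_projective _⟩
      · push Not at hprime
        obtain ⟨a, b, hab, ha, hb⟩ := hprime htop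
        refine exists_isSeqVeryFlat_baseChange_of_quotient_of_away F₀ _ (hquot a ha) ?_
        have := Module.Flat.tensor_of_isScalarTower (R₀ := R₀) F₀ A (Localization.Away (algebraMap R₀ A a))
        refine ih (I ⊔ Ideal.span {b})
          (left_lt_sup.2 fun h ↦ hb (h (Ideal.mem_span_singleton_self b))) _ (sup_le (haway a) ?_)
        rw [Ideal.span_singleton_le_iff_mem, RingHom.mem_ker, ← (hunit a).mul_right_eq_zero,
          ← map_mul]
        exact haway a hab

end Induction

/-! ### Descent to a Noetherian base. -/

section Model

theorem nonempty_equiv_tensor_quotient_span {T₀ T : Type*} [CommRing T₀] [CommRing T] [Algebra T₀ T]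
    {ι κ : Type*} [Fintype κ] [DecidableEq κ] (g : ι → κ → T₀) {F : Type*} [AddCommGroup F]
    [Module T F] (f : (κ → T) →ₗ[T] F) (hf : Function.Surjective f)
    (hker : LinearMap.ker f = Submodule.span T (Set.range fun j i ↦ algebraMap T₀ T (g j i))) :
    Nonempty (T ⊗[T₀] ((κ → T₀) ⧸ Submodule.span T₀ (Set.range g)) ≃ₗ[T] F) := by
  let N := Submodule.span T₀ (Set.range g)
  let e := TensorProduct.piScalarRight T₀ T T κ
  have h1 : LinearMap.ker (N.mkQ.baseChange T) = N.baseChange T :=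
    LinearMap.exact_iff.1 (show Function.Exact (N.subtype.baseChange T) (N.mkQ.baseChange T) from
      lTensor_exact T (LinearMap.exact_subtype_mkQ N) N.mkQ_surjective)
  have h2 : LinearMap.ker (f ∘ₗ e.toLinearMap) = N.baseChange T := by
    rw [LinearMap.ker_comp, hker, Submodule.baseChange_span, Submodule.comap_equiv_eq_map_symm,
      Submodule.map_span, ← Set.range_comp, ← Set.range_comp]
    congr 2
    ext j : 1
    simp only [Function.comp_apply, LinearEquiv.coe_coe]
    rw [LinearEquiv.symm_apply_eq]
    ext i
    simp [e, Algebra.smul_def]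
  exact ⟨((N.mkQ.baseChange T).quotKerEquivOfSurjective
    (LinearMap.lTensor_surjective T N.mkQ_surjective)).symm ≪≫ₗ
    Submodule.quotEquivOfEq _ _ (h1.trans h2.symm) ≪≫ₗ
    (f ∘ₗ e.toLinearMap).quotKerEquivOfSurjective (hf.comp e.surjective)⟩

-- A finite presentation of `F` involves finitely many coefficients; they generate a finite type
-- `ℤ`-algebra over which the same relation matrix defines `F₁`.
attribute [local instance] MvPolynomial.algebraMvPolynomial in
theorem exists_noetherian_model {R : Type u} [CommRing R] (n : ℕ) (F : Type (max u v))
    [AddCommGroup F] [Module R F] [Module (MvPolynomial (Fin n) R) F]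
    [IsScalarTower R (MvPolynomial (Fin n) R) F]
    [Module.FinitePresentation (MvPolynomial (Fin n) R) F] :
    ∃ (R₀ : Type u) (_ : CommRing R₀) (_ : IsNoetherianRing R₀) (_ : Algebra R₀ R)
      (F₀ : Type (max u v)) (_ : AddCommGroup F₀) (_ : Module R₀ F₀)
      (_ : Module (MvPolynomial (Fin n) R₀) F₀) (_ : IsScalarTower R₀ (MvPolynomial (Fin n) R₀) F₀)
      (_ : Module.Finite (MvPolynomial (Fin n) R₀) F₀), Nonempty (R ⊗[R₀] F₀ ≃ₗ[R] F) := by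
  classical
  obtain ⟨k, m, f, g, hf, hfg⟩ :=
    Module.FinitePresentation.exists_fin' (MvPolynomial (Fin n) R) F
  let c : Finset R := Finset.univ.biUnion fun j : Fin m ↦ Finset.univ.biUnion fun i : Fin k ↦
    (g (Pi.single j 1) i).coeffs
  let R₀ := Algebra.adjoin ℤ (c : Set R)
  have hR₀ : IsNoetherianRing R₀ := by
    have : Algebra.FiniteType ℤ R₀ := Subalgebra.fg_iff_finiteType _ |>.1 ⟨c, rfl⟩
    exact Algebra.FiniteType.isNoetherianRing ℤ R₀
  have hlift (j : Fin m) (i : Fin k) : ∃ p : MvPolynomial (Fin n) R₀,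
      MvPolynomial.map (algebraMap R₀ R) p = g (Pi.single j 1) i := by
    refine MvPolynomial.mem_range_map_iff_coeffs_subset.2 fun x hx ↦ ⟨⟨x, ?_⟩, rfl⟩
    refine Algebra.subset_adjoin ?_
    simp only [c, Finset.coe_biUnion, Set.mem_iUnion]
    exact ⟨j, Finset.mem_coe.2 (Finset.mem_univ _), i, Finset.mem_coe.2 (Finset.mem_univ _), hx⟩
  choose g₀ hg₀ using hlift
  let F₁ := (Fin k → MvPolynomial (Fin n) R₀) ⧸
    Submodule.span (MvPolynomial (Fin n) R₀) (Set.range g₀)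
  obtain ⟨e⟩ := nonempty_equiv_tensor_quotient_span g₀ f hf (by
    rw [LinearMap.exact_iff.1 hfg, ← Submodule.map_top, ← (Pi.basisFun _ (Fin m)).span_eq,
      Submodule.map_span, ← Set.range_comp]
    congr 2
    ext j i : 2
    simp only [Function.comp_apply, Pi.basisFun_apply, ← hg₀]
    rfl)
  refine ⟨R₀, inferInstance, hR₀, inferInstance, ULift.{v} F₁, inferInstance, inferInstance,
    inferInstance, inferInstance, inferInstance, ⟨?_⟩⟩
  exact AlgebraTensorModule.congr (.refl R R) ULift.moduleEquiv ≪≫ₗ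
    (Algebra.IsPushout.cancelBaseChange R₀ R (MvPolynomial (Fin n) R₀)
      (MvPolynomial (Fin n) R) F₁).symm ≪≫ₗ e.restrictScalars R

end Model

/-! ### Comparison with the Ext groups of the category of modules. -/

section ExtBridge

variable {R : Type u} [CommRing R]

theorem subsingleton_ext_one_iff {F : Type (max u v)} [AddCommGroup F] [Module R F]
    {C : Type (max u v)} [AddCommGroup C] [Module R C] :
    Subsingleton (Abelian.Ext (ModuleCat.of.{max u v} R F) (ModuleCat.of.{max u v} R C) 1) ↔
      ExtVanishes R F C := by
  obtain ⟨K, P, _, _, _, _, _, i, p, hi, hp, he⟩ := exists_projective_presentation R F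
  rw [extVanishes_iff hi hp he]
  let S : ShortComplex (ModuleCat.{max u v} R) :=
    ShortComplex.mk (ModuleCat.ofHom i) (ModuleCat.ofHom p) (by
      rw [← ModuleCat.ofHom_comp, he.linearMap_comp_eq_zero]; rfl)
  have hS : S.ShortExact :=
    { exact := (ShortComplex.ShortExact.moduleCat_exact_iff_function_exact S).2 he
      mono_f := (ModuleCat.mono_iff_injective _).2 hi
      epi_g := (ModuleCat.epi_iff_surjective _).2 hp }
  have : Projective S.X₂ := (IsProjective.iff_projective P).1 inferInstance
  constructor
  · intro h φ
    obtain ⟨x, hx⟩ := Abelian.Ext.contravariant_sequence_exact₁ hS (ModuleCat.of R C)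
      (Abelian.Ext.mk₀ (ModuleCat.ofHom φ)) (add_zero 1) (h.elim _ _)
    obtain ⟨ψ, rfl⟩ := (Abelian.Ext.mk₀_bijective _ _).2 x
    rw [Abelian.Ext.mk₀_comp_mk₀] at hx
    have := (Abelian.Ext.mk₀_bijective _ _).1 hx
    exact ⟨ψ.hom, congrArg ModuleCat.Hom.hom this⟩
  · intro h
    refine subsingleton_of_forall_eq 0 fun x ↦ ?_
    obtain ⟨y, hy⟩ := Abelian.Ext.contravariant_sequence_exact₃ hS (ModuleCat.of R C) x
      (Abelian.Ext.eq_zero_of_projective _) (add_zero 1)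
    obtain ⟨φ, rfl⟩ := (Abelian.Ext.mk₀_bijective _ _).2 y
    obtain ⟨ψ, hψ⟩ := h φ.hom
    have : φ = S.f ≫ ModuleCat.ofHom ψ := by
      ext x
      exact (LinearMap.congr_fun hψ x).symm
    rw [← hy, this, ← Abelian.Ext.mk₀_comp_mk₀, ShortComplex.ShortExact.extClass_comp_assoc]

open Polynomial in
theorem IsElementContraadjusted.isSeqContraadjusted {r : R} {C : Type (max u v)} [AddCommGroup C]
    [Module R C] (h : IsElementContraadjusted.{u, v} r C) : IsSeqContraadjusted r C := by
  have h' := subsingleton_ext_one_iff.1 h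
  -- The free presentation `R[r⁻¹] = R[X]/(rX - 1)`; the sign change to `1 - rX` does not affect the
  -- ideal.
  let p : R[X] →ₗ[R] ULift.{v} (Localization.Away r) :=
    ULift.moduleEquiv.symm.toLinearMap ∘ₗ (Localization.awayEquivAdjoin r).symm.toLinearMap ∘ₗ
      (AdjoinRoot.mkₐ (Polynomial.C r * X - 1 : R[X])).toLinearMap.restrictScalars R
  have hp : Function.Surjective p :=
    ULift.moduleEquiv.symm.surjective.comp ((Localization.awayEquivAdjoin r).symm.surjective.comp
      AdjoinRoot.mk_surjective)
  have he : Function.Exact (LinearMap.mulLeft R (1 - Polynomial.C r * X : R[X])) p := fun x ↦ by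
    have : p x = 0 ↔ (Polynomial.C r * X - 1) ∣ x := by
      rw [← AdjoinRoot.mk_eq_zero, ← map_eq_zero_iff (Localization.awayEquivAdjoin r).symm
        (Localization.awayEquivAdjoin r).symm.injective,
        ← (ULift.moduleEquiv.{u, u, v} (R := R)).symm.map_eq_zero_iff]
      rfl
    rw [this, Set.mem_range]
    constructor
    · rintro ⟨y, rfl⟩
      exact ⟨-y, by rw [LinearMap.mulLeft_apply]; ring⟩
    · rintro ⟨y, rfl⟩
      exact ⟨-y, by rw [LinearMap.mulLeft_apply]; ring⟩
  refine isSeqContraadjusted_of_forall_polynomial r fun g ↦ ?_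
  obtain ⟨f, hf⟩ := (extVanishes_iff (one_sub_C_mul_X_mul_injective r) hp he).1 h' g
  exact ⟨f, fun x ↦ LinearMap.congr_fun hf x⟩

theorem IsSeqVeryFlat.isVeryFlatWrt {s : Finset R} {F : Type (max u v)} [AddCommGroup F]
    [Module R F] (h : IsSeqVeryFlat.{u, v} s F) : IsVeryFlatWrt.{u, v} s F :=
  fun C _ _ hC ↦ subsingleton_ext_one_iff.2 (h C fun r hr ↦ (hC r hr).isSeqContraadjusted)

end ExtBridge

theorem exists_isSeqVeryFlat_of_mvPolynomial {R : Type u} [CommRing R] (n : ℕ)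
    (F : Type (max u v)) [AddCommGroup F] [Module R F] [Module (MvPolynomial (Fin n) R) F]
    [IsScalarTower R (MvPolynomial (Fin n) R) F]
    [Module.FinitePresentation (MvPolynomial (Fin n) R) F] [Module.Flat R F] :
    ∃ s : Finset R, IsSeqVeryFlat.{u, v} s F := by
  obtain ⟨R₀, _, _, _, F₀, _, _, _, _, _, ⟨e⟩⟩ := exists_noetherian_model.{u, v} (R := R) n F
  have : Module.Flat R (R ⊗[R₀] F₀) := .of_linearEquiv e
  obtain ⟨s, hs⟩ := exists_isSeqVeryFlat_baseChange_of_le_ker.{u, v} n F₀ (⊥ : Ideal R₀) R bot_le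
  exact ⟨s, hs.of_equiv e⟩

theorem theorem1p4 {R : Type u} [CommRing R]
    {S : Type w} [CommRing S] [Algebra R S] [Algebra.FinitePresentation R S]
    (F : Type (max u v)) [AddCommGroup F] [Module R F] [Module S F] [IsScalarTower R S F]
    [Module.FinitePresentation S F] [Module.Flat R F] :
    IsFinitelyVeryFlat.{u, v} R F := by
  obtain ⟨n, φ, hφ, hker⟩ := Algebra.FinitePresentation.out (R := R) (A := S)
  let T := MvPolynomial (Fin n) R
  let _ : Algebra T S := φ.toRingHom.toAlgebra
  let _ : Module T F := Module.compHom F φ.toRingHom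
  have hsmul (t : T) (x : F) : t • x = φ t • x := rfl
  have : IsScalarTower T S F := ⟨fun t s x ↦ by
    rw [hsmul, smul_smul, Algebra.smul_def]
    rfl⟩
  have : IsScalarTower R T F := ⟨fun r t x ↦ by
    rw [hsmul, hsmul, map_smul, smul_assoc]⟩
  have : Module.FinitePresentation T S :=
    Module.finitePresentation_of_surjective (Algebra.linearMap T S) hφ hker
  have : Module.FinitePresentation T F := .trans T F S
  obtain ⟨s, hs⟩ := exists_isSeqVeryFlat_of_mvPolynomial.{u, v} (R := R) n F
  exact ⟨s, hs.isVeryFlatWrt⟩
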